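/- Let $G=(V,E)$ be a finite simple graph and let $\beta,h\in\mathbb R$. The Ising model on $G$ assigns to each vertex the weight $e^{h}$ if its spin is $+1$ and $e^{-h}$ if its spin is $-1$, and to each edge the weight $e^{-\beta}$ if the spins of its two endpoints agree and $e^{\beta}$ if they differ. The weight $w_{\beta,h}(\sigma)$ of a configuration $\sigma:V\to\{+1,-1\}$ is the product of all these vertex and edge weights, that is, $$w_{\beta,h}(\sigma)=\exp\Big\{-\beta\sum_{uv\in E}\sigma(u)\sigma(v)+h\sum_{v\in V}\sigma(v)\Big\},$$ and the partition function is $Z_{\beta,h}(G)=\sum_{\sigma}w_{\beta,h}(\sigma)$. If $G$ has $N\ge 1$ vertices, its free energy is $F_{\beta,h}(G)=\ln (Z_{\beta,h}(G))/N$. (1) For every $\beta>0$ (the antiferromagnetic case), every $d\ge 0$, every $N\ge 1$ and every $d$-regular bipartite graph $G$ with $N$ vertices, $$\frac{\beta d}{2}\;\le\; F_{\beta,0}(G)\;\le\;\frac{\beta d}{2}+\ln 2 .$$ In particular both bounds are independent of $G$ and $N$, given $d$ and $\beta$. (2) Both bounds are asymptotically tight for families with $\beta d\to\infty$: if $(G_i)_{i\in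 I}$ is a family of non-empty finite bipartite graphs, $G_i$ being $d_i$-regular, if $\beta_i>0$ for all $i$, and if $\beta_i d_i\to\infty$ along some filter on $I$ (for instance, along a sequence), then, along the same filter, $F_{\beta_i,0}(G_i)\sim \beta_i d_i/2$ and $F_{\beta_i,0}(G_i)\sim \beta_i d_i/2+\ln 2$, where $a_i\sim b_i$ means $a_i/b_i\to1$. -/

import Mathlib

open scoped Asymptotics

/-- A system of non-negative weights on the spin set `S` for a graph with vertex set `V`:
a weight for each spin at each vertex, and a weight for each unordered pair of spins at each
edge. (Edge weights are indexed by all unordered pairs of vertices; only the values at edges of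
the graph at hand are ever used.) -/
structure WeightSystem (S V : Type*) where
  vertex : S → V → ℝ
  edge : Sym2 S → Sym2 V → ℝ
  vertex_nonneg : ∀ i v, 0 ≤ vertex i v
  edge_nonneg : ∀ p e, 0 ≤ edge p e

namespace WeightSystem

variable {S V : Type*}

/-- The weight `∏_v λ_{f(v),v} ∏_{uv ∈ E} λ_{f(u)f(v),uv}` of a configuration `f`.
For an edge `e = s(u, v)`, `e.map f = s(f u, f v)`. -/
def weight [Fintype V] (W : WeightSystem S V) (G : SimpleGraph V) [Fintype G.edgeSet]
    (f : V → S) : ℝ :=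
  (∏ v : V, W.vertex (f v) v) * ∏ e ∈ G.edgeFinset, W.edge (e.map f) e

/-- The partition function: the sum of the weights of all configurations. -/
def partitionFunction [Fintype S] [Fintype V] [DecidableEq V] (W : WeightSystem S V)
    (G : SimpleGraph V) [Fintype G.edgeSet] : ℝ :=
  ∑ f : V → S, W.weight G f

/-- The free energy `log Z / N`, with `N` the number of vertices. -/
noncomputable def freeEnergy [Fintype S] [Fintype V] [DecidableEq V] (W : WeightSystem S V)
    (G : SimpleGraph V) [Fintype G.edgeSet] : ℝ :=
  Real.log (W.partitionFunction G) / (Fintype.card V : ℝ)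

end WeightSystem

/-- The Ising weights with parameters `β` and `h`. The spin set `{+1, -1}` is `ℤˣ`;
an unordered pair of spins is diagonal exactly when the two spins agree. -/
noncomputable def isingWeights (V : Type*) (β h : ℝ) : WeightSystem ℤˣ V where
  vertex i _ := if i = 1 then Real.exp h else Real.exp (-h)
  edge p _ := if p.IsDiag then Real.exp (-β) else Real.exp β
  vertex_nonneg i v := by split_ifs <;> positivity
  edge_nonneg p e := by split_ifs <;> positivity


/-!
A configuration of maximal weight `w` satisfies `w ≤ Z ≤ |S| ^ N * w`, so the free energy lies
within `log |S|` of `log w / N`. No Ising configuration without external field weighs more than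
`exp (|β| * |E|)`. A constant configuration attains this bound when `β ≤ 0`, and the two colour
classes of a bipartite graph attain it when `β ≥ 0`. For a `d`-regular graph `|E| / N = d / 2`.
-/

open Filter Finset

namespace WeightSystem

variable {S V : Type*} [Fintype V] (W : WeightSystem S V) (G : SimpleGraph V) [Fintype G.edgeSet]

theorem weight_nonneg (f : V → S) : 0 ≤ W.weight G f :=
  mul_nonneg (prod_nonneg fun _ _ => W.vertex_nonneg _ _)
    (prod_nonneg fun _ _ => W.edge_nonneg _ _)

variable [Fintype S] [DecidableEq V]

theorem weight_le_partitionFunction (f : V → S) : W.weight G f ≤ W.partitionFunction G :=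
  single_le_sum (fun g _ => W.weight_nonneg G g) (mem_univ f)

variable {W G}

theorem partitionFunction_le_of_weight_le {M : ℝ} (hM : ∀ f, W.weight G f ≤ M) :
    W.partitionFunction G ≤ (Fintype.card S : ℝ) ^ Fintype.card V * M :=
  calc W.partitionFunction G ≤ ∑ _f : V → S, M := sum_le_sum fun f _ => hM f
    _ = (Fintype.card S : ℝ) ^ Fintype.card V * M := by simp

theorem log_weight_div_card_le_freeEnergy {f : V → S} (hf : 0 < W.weight G f) :
    Real.log (W.weight G f) / Fintype.card V ≤ W.freeEnergy G :=
  div_le_div_of_nonneg_right (Real.log_le_log hf (W.weight_le_partitionFunction G f))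
    (Nat.cast_nonneg _)

theorem freeEnergy_le_of_forall_weight_le [Nonempty V] {f : V → S} (hf : 0 < W.weight G f)
    (hmax : ∀ g, W.weight G g ≤ W.weight G f) :
    W.freeEnergy G ≤ Real.log (W.weight G f) / Fintype.card V + Real.log (Fintype.card S) := by
  have : Nonempty S := ‹Nonempty V›.map f
  have hZ : 0 < W.partitionFunction G := hf.trans_le (W.weight_le_partitionFunction G f)
  have hS : (Fintype.card S : ℝ) ≠ 0 := Nat.cast_ne_zero.2 Fintype.card_ne_zero
  have hN : (0 : ℝ) < Fintype.card V := Nat.cast_pos.2 Fintype.card_pos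
  have hlog : Real.log (W.partitionFunction G) ≤
      Real.log (W.weight G f) + Real.log (Fintype.card S) * Fintype.card V :=
    calc Real.log (W.partitionFunction G)
        ≤ Real.log ((Fintype.card S : ℝ) ^ Fintype.card V * W.weight G f) :=
          Real.log_le_log hZ (partitionFunction_le_of_weight_le hmax)
      _ = Real.log (W.weight G f) + Real.log (Fintype.card S) * Fintype.card V := by
          rw [Real.log_mul (pow_ne_zero _ hS) hf.ne', Real.log_pow]
          ring
  rwa [freeEnergy, div_le_iff₀ hN, add_mul, div_mul_cancel₀ _ hN.ne']

end WeightSystem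

section Ising

variable {V : Type*} [Fintype V] {G : SimpleGraph V} [Fintype G.edgeSet] {β : ℝ} {f : V → ℤˣ}

theorem isingWeights_zero_weight :
    (isingWeights V β 0).weight G f =
      ∏ e ∈ G.edgeFinset, if (e.map f).IsDiag then Real.exp (-β) else Real.exp β := by
  simp [WeightSystem.weight, isingWeights]

theorem isingWeights_zero_weight_le :
    (isingWeights V β 0).weight G f ≤ Real.exp (|β| * #G.edgeFinset) := by
  rw [isingWeights_zero_weight, mul_comm, Real.exp_nat_mul, ← prod_const]
  refine prod_le_prod (fun e _ => by split_ifs <;> positivity) fun e _ => ?_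
  split_ifs
  · exact Real.exp_le_exp.2 (neg_le_abs β)
  · exact Real.exp_le_exp.2 (le_abs_self β)

theorem isingWeights_zero_weight_of_forall_adj_eq (hf : ∀ u v, G.Adj u v → f u = f v) :
    (isingWeights V β 0).weight G f = Real.exp (-β * #G.edgeFinset) := by
  rw [isingWeights_zero_weight, mul_comm, Real.exp_nat_mul, ← prod_const]
  refine prod_congr rfl fun e he => ?_
  induction e with
  | _ u v => exact if_pos (hf u v (SimpleGraph.mem_edgeFinset.1 he))

theorem isingWeights_zero_weight_of_forall_adj_ne (hf : ∀ u v, G.Adj u v → f u ≠ f v) :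
    (isingWeights V β 0).weight G f = Real.exp (β * #G.edgeFinset) := by
  rw [isingWeights_zero_weight, mul_comm, Real.exp_nat_mul, ← prod_const]
  refine prod_congr rfl fun e he => ?_
  induction e with
  | _ u v => exact if_neg (hf u v (SimpleGraph.mem_edgeFinset.1 he))

theorem exists_isingWeights_zero_weight_eq (hβG : β ≤ 0 ∨ G.IsBipartite) :
    ∃ f, (isingWeights V β 0).weight G f = Real.exp (|β| * #G.edgeFinset) := by
  rcases le_or_gt β 0 with hβ | hβ
  · rw [abs_of_nonpos hβ]
    exact ⟨1, isingWeights_zero_weight_of_forall_adj_eq fun _ _ _ => rfl⟩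
  · rw [abs_of_pos hβ]
    have hG : G.IsBipartite := hβG.resolve_left hβ.not_ge
    let C : G.Coloring ℤˣ := hG.toColoring (by decide)
    exact ⟨C, isingWeights_zero_weight_of_forall_adj_ne fun _ _ => C.valid⟩

theorem isingWeights_zero_freeEnergy_bounds [DecidableEq V] [Nonempty V]
    (hβG : β ≤ 0 ∨ G.IsBipartite) :
    |β| * #G.edgeFinset / Fintype.card V ≤ (isingWeights V β 0).freeEnergy G ∧
      (isingWeights V β 0).freeEnergy G ≤
        |β| * #G.edgeFinset / Fintype.card V + Real.log 2 := by
  obtain ⟨f, hf⟩ := exists_isingWeights_zero_weight_eq hβG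
  have hpos : 0 < (isingWeights V β 0).weight G f := hf ▸ Real.exp_pos _
  have hmax (g : V → ℤˣ) : (isingWeights V β 0).weight G g ≤ (isingWeights V β 0).weight G f :=
    isingWeights_zero_weight_le.trans_eq hf.symm
  have hlog : Real.log ((isingWeights V β 0).weight G f) = |β| * #G.edgeFinset := by
    rw [hf, Real.log_exp]
  rw [← hlog]
  refine ⟨WeightSystem.log_weight_div_card_le_freeEnergy hpos, ?_⟩
  simpa [Fintype.card_units_int] using WeightSystem.freeEnergy_le_of_forall_weight_le hpos hmax

end Ising

theorem mul_card_edgeFinset_div_card_of_isRegularOfDegree {V : Type*} [Fintype V] [Nonempty V]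
    {G : SimpleGraph V} [DecidableRel G.Adj] {d : ℕ} (hd : G.IsRegularOfDegree d) (a : ℝ) :
    a * #G.edgeFinset / Fintype.card V = a * d / 2 := by
  have handshake : Fintype.card V * d = 2 * #G.edgeFinset := by
    simpa [hd.degree_eq] using G.sum_degrees_eq_twice_card_edges
  have handshake_real : (Fintype.card V : ℝ) * d = 2 * #G.edgeFinset := mod_cast handshake
  have hN : (Fintype.card V : ℝ) ≠ 0 := Nat.cast_ne_zero.2 Fintype.card_ne_zero
  rw [div_eq_div_iff hN two_ne_zero]
  linear_combination -a * handshake_real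

theorem isEquivalent_of_isBigO_one {ι E : Type*} [NormedAddCommGroup E] {l : Filter ι}
    {u v : ι → E} (hv : Tendsto (fun i => ‖v i‖) l atTop)
    (huv : (u - v) =O[l] (1 : ι → ℝ)) : u ~[l] v :=
  huv.trans_isLittleO ((Asymptotics.isLittleO_one_left_iff ℝ).2 hv)

theorem isEquivalent_of_le_of_le_add_const {ι : Type*} {l : Filter ι} {u v : ι → ℝ} {c : ℝ}
    (hv : Tendsto v l atTop) (hvu : ∀ᶠ i in l, v i ≤ u i) (huv : ∀ᶠ i in l, u i ≤ v i + c) :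
    u ~[l] v ∧ u ~[l] fun i => v i + c := by
  have hnorm : Tendsto (fun i => ‖v i‖) l atTop := tendsto_norm_atTop_atTop.comp hv
  have h : u ~[l] v := by
    refine isEquivalent_of_isBigO_one hnorm (.of_bound c ?_)
    filter_upwards [hvu, huv] with i hvu huv
    simp [abs_of_nonneg (sub_nonneg.2 hvu), huv, add_comm c]
  exact ⟨h, h.trans (Asymptotics.IsEquivalent.refl.add_const_of_norm_tendsto_atTop hnorm).symm⟩

theorem mainTheorem4_general :
    (∀ (V : Type*) [Fintype V] [DecidableEq V] [Nonempty V]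
        (G : SimpleGraph V) [Fintype G.edgeSet] (β : ℝ), β ≤ 0 ∨ G.IsBipartite →
        |β| * #G.edgeFinset / Fintype.card V ≤ (isingWeights V β 0).freeEnergy G ∧
          (isingWeights V β 0).freeEnergy G ≤
            |β| * #G.edgeFinset / Fintype.card V + Real.log 2) ∧
    (∀ (ι : Type*) (l : Filter ι) (V : ι → Type*)
        [∀ i, Fintype (V i)] [∀ i, DecidableEq (V i)] [∀ i, Nonempty (V i)]
        (G : ∀ i, SimpleGraph (V i)) [∀ i, Fintype (G i).edgeSet] (β : ι → ℝ),
        (∀ i, β i ≤ 0 ∨ (G i).IsBipartite) →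
        Tendsto (fun i => |β i| * #(G i).edgeFinset / Fintype.card (V i)) l atTop →
        ((fun i => (isingWeights (V i) (β i) 0).freeEnergy (G i)) ~[l]
            fun i => |β i| * #(G i).edgeFinset / Fintype.card (V i)) ∧
          ((fun i => (isingWeights (V i) (β i) 0).freeEnergy (G i)) ~[l]
            fun i => |β i| * #(G i).edgeFinset / Fintype.card (V i) + Real.log 2)) := by
  refine ⟨fun V _ _ _ G _ β hβG => isingWeights_zero_freeEnergy_bounds hβG,
    fun ι l V _ _ _ G _ β hβG hlim => ?_⟩
  have hF (i : ι) := isingWeights_zero_freeEnergy_bounds (hβG i)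
  exact isEquivalent_of_le_of_le_add_const hlim (.of_forall fun i => (hF i).1)
    (.of_forall fun i => (hF i).2)

theorem mainTheorem4 :
    (∀ (V : Type*) [Fintype V] [DecidableEq V] [Nonempty V]
        (G : SimpleGraph V) [DecidableRel G.Adj] (d : ℕ) (β : ℝ),
        G.IsBipartite → G.IsRegularOfDegree d → 0 < β →
        β * d / 2 ≤ (isingWeights V β 0).freeEnergy G ∧
          (isingWeights V β 0).freeEnergy G ≤ β * d / 2 + Real.log 2) ∧
    (∀ (ι : Type*) (l : Filter ι) (V : ι → Type*)
        [∀ i, Fintype (V i)] [∀ i, DecidableEq (V i)] [∀ i, Nonempty (V i)]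
        (G : ∀ i, SimpleGraph (V i)) [∀ i, DecidableRel (G i).Adj] (d : ι → ℕ) (β : ι → ℝ),
        (∀ i, (G i).IsBipartite) → (∀ i, (G i).IsRegularOfDegree (d i)) → (∀ i, 0 < β i) →
        Filter.Tendsto (fun i => β i * d i) l Filter.atTop →
        ((fun i => (isingWeights (V i) (β i) 0).freeEnergy (G i)) ~[l]
            fun i => β i * d i / 2) ∧
          ((fun i => (isingWeights (V i) (β i) 0).freeEnergy (G i)) ~[l]
            fun i => β i * d i / 2 + Real.log 2)) := by
  obtain ⟨bounds, asymptotics⟩ := mainTheorem4_general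
  refine ⟨fun V _ _ _ G _ d β hG hd hβ => ?_, fun ι l V _ _ _ G _ d β hG hd hβ hlim => ?_⟩
  · simpa only [abs_of_pos hβ, mul_card_edgeFinset_div_card_of_isRegularOfDegree hd]
      using bounds V G β (.inr hG)
  · have hE (i : ι) : |β i| * #(G i).edgeFinset / Fintype.card (V i) = β i * d i / 2 := by
      rw [abs_of_pos (hβ i), mul_card_edgeFinset_div_card_of_isRegularOfDegree (hd i)]
    simpa only [hE] using asymptotics ι l V G β (fun i => .inr (hG i))
      (by simpa only [hE] using hlim.atTop_div_const two_pos)
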